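/- Let $X$ be a compact metric space and let $C(X)$ be the C*-algebra of continuous complex-valued functions on $X$. The following are equivalent: 1. $C(X)$ is C*-tracially stable. 2. $X$ is approximately path-connected. 3. For every state $\tau$ on $C(X)$ there is a sequence of unital $*$-homomorphisms $\pi_n\colon C(X)\to C[0,1]$ such that for every $f\in C(X)$ $$\tau(f)=\lim_{n\to\infty}\int_0^1 \pi_n(f)(x)\,dx .$$ Here a topological space $X$ is called approximately path-connected if for all nonempty open sets $V_1,\dots,V_s\subseteq X$ ($s\ge 1$) there is a continuous $\gamma\colon[0,1]\to X$ with $\gamma((0,1))\cap V_k\neq\varnothing$ for $1\le k\le s$. An ultrafilter $\alpha$ on a set $I$ is nontrivial if it contains a sequence of sets with empty intersection. If $\alpha$ is a nontrivial ultrafilter on $I$ and, for each $i\in I$, $\mathcal A_i$ is a unital C*-algebra with a tracial state $\rho_i$, then the tracial ultraproduct $\prod^{\alpha}_{i\in I}(\mathcal A_i,\rho_i)$ is the quotient of the C*-product $\prod_{i\in I}\mathcal A_i$ (all norm-bounded families) by the ideal of all $\{a_i\}$ with $\lim_{i\to\alpha}\rho_i(a_i^*a_i)=0$; the coset of $\{a_i\}$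 is denoted $\{a_i\}_\alpha$. A unital C*-algebra $\mathcal A$ is C*-tracially stable if for every unital $*$-homomorphism $\pi$ from $\mathcal A$ into any such tracial ultraproduct there are a set $E\in\alpha$ and, for each $i\in E$, a unital $*$-homomorphism $\pi_i\colon\mathcal A\to\mathcal A_i$ such that $\pi(a)=\{\pi_i(a)\}_\alpha$ for every $a\in\mathcal A$, where $\pi_i(a):=0$ for $i\notin E$. -/

import Mathlib

open scoped ENNReal Topology ComplexOrder

universe u v w

/-- A state on a unital C⋆-algebra: a positive linear functional of value `1` at the unit.
(`0 ≤ z` for a complex number `z` means that `z` is real and nonnegative.) -/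
structure IsState {A : Type*} [CStarAlgebra A] (φ : A →ₗ[ℂ] ℂ) : Prop where
  nonneg : ∀ a : A, 0 ≤ φ (star a * a)
  map_one : φ 1 = 1

/-- A tracial state: a state `ρ` with `ρ (a b) = ρ (b a)`. -/
structure IsTracialState {A : Type*} [CStarAlgebra A] (ρ : A →ₗ[ℂ] ℂ) : Prop
    extends IsState ρ where
  mul_comm : ∀ a b : A, ρ (a * b) = ρ (b * a)

/-- The type of tracial states of a unital C⋆-algebra. -/
def TracialState (A : Type*) [CStarAlgebra A] : Type _ :=
  {ρ : A →ₗ[ℂ] ℂ // IsTracialState ρ}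

/-- The `2`-(semi)norm `‖a‖₂ = ρ (a⋆ a) ^ (1/2)` of a tracial state. -/
noncomputable def TracialState.twoNorm {A : Type*} [CStarAlgebra A] (ρ : TracialState A)
    (a : A) : ℝ :=
  Real.sqrt (ρ.1 (star a * a)).re

namespace TracialState

variable {A : Type*} [CStarAlgebra A] (ρ : TracialState A)

theorem re_nonneg (a : A) : 0 ≤ (ρ.1 (star a * a)).re :=
  (Complex.nonneg_iff.1 (ρ.2.nonneg a)).1

theorem twoNorm_sq (a : A) : ρ.twoNorm a ^ 2 = (ρ.1 (star a * a)).re :=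
  Real.sq_sqrt (ρ.re_nonneg a)

theorem twoNorm_star (a : A) : ρ.twoNorm (star a) = ρ.twoNorm a := by
  unfold twoNorm
  rw [star_star, ρ.2.mul_comm]

theorem twoNorm_add_sq_le (a b : A) :
    ρ.twoNorm (a + b) ^ 2 ≤ 2 * ρ.twoNorm a ^ 2 + 2 * ρ.twoNorm b ^ 2 := by
  simp only [twoNorm_sq]
  have h := ρ.re_nonneg (a - b)
  simp only [star_add, star_sub, mul_add, add_mul, mul_sub, sub_mul, map_add, map_sub,
    Complex.add_re, Complex.sub_re] at h ⊢
  linarith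

theorem re_mono {a b : A} (h : ∃ c : A, b - a = star c * c) : (ρ.1 a).re ≤ (ρ.1 b).re := by
  obtain ⟨c, hc⟩ := h
  have h := ρ.re_nonneg c
  rw [← hc, map_sub, Complex.sub_re] at h
  linarith

theorem twoNorm_mul_sq_le (a b : A) :
    ρ.twoNorm (a * b) ^ 2 ≤ ‖a‖ ^ 2 * ρ.twoNorm b ^ 2 := by
  simp only [twoNorm_sq]
  have key : (ρ.1 (star (a * b) * (a * b))).re ≤
      (ρ.1 (((‖a‖ ^ 2 : ℝ) : ℂ) • (star b * b))).re := by
    apply ρ.re_mono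
    let _ := CStarAlgebra.spectralOrder A
    let _ := CStarAlgebra.spectralOrderedRing A
    have h : star b * (star a * a) * b ≤ ‖star a * a‖ • (star b * b) :=
      CStarAlgebra.star_left_conjugate_le_norm_smul
    obtain ⟨c, hc⟩ := CStarAlgebra.nonneg_iff_eq_star_mul_self.1 (sub_nonneg.2 h)
    refine ⟨c, ?_⟩
    rw [← hc, CStarRing.norm_star_mul_self, ← sq, Complex.coe_smul]
    simp only [star_mul, mul_assoc]
  rwa [map_smul, smul_eq_mul, Complex.re_ofReal_mul] at key

end TracialState

/-- An ultrafilter is nontrivial if it contains a sequence of sets with empty intersection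
(so the index set is infinite). -/
def Ultrafilter.IsNontrivial {I : Type*} (α : Ultrafilter I) : Prop :=
  ∃ E : ℕ → Set I, (∀ n, E n ∈ α) ∧ ⋂ n, E n = ∅

section Ultraproduct

variable {I : Type v} {B : I → Type w} [∀ i, CStarAlgebra (B i)] [∀ i, Nontrivial (B i)]

/-- The ideal of all bounded families `a` with `‖a i‖₂ ^ 2 → 0` along `α`. Here `lp B ∞` is the
C⋆-product: all families with `sup ‖a i‖ < ∞`, with pointwise operations. -/
def traceIdeal (α : Ultrafilter I) (ρ : ∀ i, TracialState (B i)) : Ideal (lp B ∞) where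
  carrier := {a | Filter.Tendsto (fun i => (ρ i).twoNorm (a i) ^ 2) α (𝓝 0)}
  zero_mem' := by
    simp [TracialState.twoNorm]
  add_mem' := by
    intro a b ha hb
    have h := (ha.const_mul 2).add (hb.const_mul 2)
    simp only [mul_zero, add_zero] at h
    exact squeeze_zero (fun i => sq_nonneg _) (fun i => (ρ i).twoNorm_add_sq_le (a i) (b i)) h
  smul_mem' := by
    intro c a ha
    have h := Filter.Tendsto.const_mul (‖c‖ ^ 2) ha
    rw [mul_zero] at h
    refine squeeze_zero (fun i => sq_nonneg _) (fun i => ?_) h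
    refine ((ρ i).twoNorm_mul_sq_le (c i) (a i)).trans ?_
    have := lp.norm_apply_le_norm ENNReal.top_ne_zero c i
    gcongr

variable (α : Ultrafilter I) (ρ : ∀ i, TracialState (B i))

theorem mem_traceIdeal {a : lp B ∞} :
    a ∈ traceIdeal α ρ ↔ Filter.Tendsto (fun i => (ρ i).twoNorm (a i) ^ 2) α (𝓝 0) :=
  Iff.rfl

theorem star_mem_traceIdeal {a : lp B ∞} (ha : a ∈ traceIdeal α ρ) :
    star a ∈ traceIdeal α ρ := by
  rw [mem_traceIdeal] at ha ⊢
  simpa only [lp.star_apply, TracialState.twoNorm_star] using ha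

instance traceIdeal_isTwoSided : (traceIdeal α ρ).IsTwoSided where
  mul_mem_of_left {a} b ha := by
    have h := star_mem_traceIdeal α ρ
      ((traceIdeal α ρ).mul_mem_left (star b) (star_mem_traceIdeal α ρ ha))
    rwa [star_mul, star_star, star_star] at h

/-- The tracial ultraproduct `∏^α (B i, ρ i)` of a family of tracial C⋆-algebras. -/
def TracialUltraproduct : Type (max v w) := lp B ∞ ⧸ traceIdeal α ρ

namespace TracialUltraproduct

noncomputable instance : Ring (TracialUltraproduct α ρ) :=
  inferInstanceAs (Ring (lp B ∞ ⧸ traceIdeal α ρ))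

noncomputable instance : Algebra ℂ (TracialUltraproduct α ρ) :=
  inferInstanceAs (Algebra ℂ (lp B ∞ ⧸ traceIdeal α ρ))

/-- The coset `{a i}_α` of a bounded family `a`. -/
noncomputable def mk (a : lp B ∞) : TracialUltraproduct α ρ := Ideal.Quotient.mk (traceIdeal α ρ) a

/-- The involution is induced by the pointwise involution: `({a i}_α)⋆ = {(a i)⋆}_α`. -/
noncomputable instance : Star (TracialUltraproduct α ρ) where
  star := Quotient.lift (fun a : lp B ∞ => mk α ρ (star a)) (by
    intro a b hab
    have h : a - b ∈ traceIdeal α ρ := (Submodule.quotientRel_def _).1 hab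
    refine Ideal.Quotient.eq.2 ?_
    rw [← star_sub]
    exact star_mem_traceIdeal α ρ h)

theorem star_mk (a : lp B ∞) : star (mk α ρ a) = mk α ρ (star a) := rfl

theorem mk_surjective : Function.Surjective (mk α ρ) := Ideal.Quotient.mk_surjective

noncomputable instance : StarRing (TracialUltraproduct α ρ) where
  star_involutive x := by
    obtain ⟨a, rfl⟩ := mk_surjective α ρ x
    rw [star_mk, star_mk, star_star]
  star_mul x y := by
    obtain ⟨a, rfl⟩ := mk_surjective α ρ x
    obtain ⟨b, rfl⟩ := mk_surjective α ρ y
    change mk α ρ (star (a * b)) = mk α ρ (star b * star a)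
    rw [star_mul]
  star_add x y := by
    obtain ⟨a, rfl⟩ := mk_surjective α ρ x
    obtain ⟨b, rfl⟩ := mk_surjective α ρ y
    change mk α ρ (star (a + b)) = mk α ρ (star a + star b)
    rw [star_add]

end TracialUltraproduct

open scoped Classical in
/-- For unital ⋆-homomorphisms `φ i : A → B i`, given for the `i` in a set `E`, and for `a` in `A`:
the bounded family equal to `φ i a` for `i` in `E` and to `0` for all other `i`. -/
noncomputable def extendByZero {A : Type u} [CStarAlgebra A] (E : Set I)
    (φ : ∀ i : E, A →⋆ₐ[ℂ] B i) (a : A) : lp B ∞ :=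
  ⟨fun i => if h : i ∈ E then φ ⟨i, h⟩ a else 0, memℓp_infty ⟨‖a‖, by
    rintro _ ⟨i, rfl⟩
    by_cases h : i ∈ E
    · simpa only [h, dite_true] using! NonUnitalStarAlgHom.norm_apply_le (φ ⟨i, h⟩) a
    · simp [h]⟩⟩

/-- A unital ⋆-homomorphism `π` into a tracial ultraproduct is approximately liftable if, for all
`i` in some `E ∈ α`, there are unital ⋆-homomorphisms `φ i : A → B i` such that
`π a = {φ i a}_α` for all `a`. -/
def IsApproximatelyLiftable {A : Type u} [CStarAlgebra A]
    (π : A →⋆ₐ[ℂ] TracialUltraproduct α ρ) : Prop :=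
  ∃ E ∈ α, ∃ φ : ∀ i : E, A →⋆ₐ[ℂ] B i,
    ∀ a : A, π a = TracialUltraproduct.mk α ρ (extendByZero E φ a)

end Ultraproduct

/-- A unital C⋆-algebra is C⋆-tracially stable if every unital ⋆-homomorphism into any tracial
ultraproduct of unital C⋆-algebras along a nontrivial ultrafilter is approximately liftable.
(`Nontrivial (B i)`, that is `1 ≠ 0`, holds whenever there is a state.) -/
def IsCStarTraciallyStable (A : Type u) [CStarAlgebra A] : Prop :=
  ∀ (I : Type v) (α : Ultrafilter I), α.IsNontrivial →
    ∀ (B : I → Type w) [∀ i, CStarAlgebra (B i)] [∀ i, Nontrivial (B i)]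
      (ρ : ∀ i, TracialState (B i)) (π : A →⋆ₐ[ℂ] TracialUltraproduct α ρ),
      IsApproximatelyLiftable α ρ π

/-- A topological space is approximately path-connected if for all nonempty open sets
`V₁, …, Vₛ` (`s ≥ 1`) there is a path `γ : [0,1] → X` such that `γ((0,1))` meets each of them. -/
def IsApproximatelyPathConnected (X : Type u) [TopologicalSpace X] : Prop :=
  ∀ s : ℕ, 1 ≤ s → ∀ V : Fin s → Set X, (∀ k, IsOpen (V k) ∧ (V k).Nonempty) →
    ∃ γ : C(unitInterval, X), ∀ k, (γ '' Set.Ioo 0 1 ∩ V k).Nonempty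

/-!
The cycle of implications runs from stability to states, from states to paths, and back.

*From stability to states.* A state `τ` of `C(X)` is integration against a probability measure, and
that measure is the distribution of a measurable map `g : [0,1] → X`. The moving averages of `f ∘ g`
are continuous and converge to `f ∘ g` almost everywhere, so they define a homomorphism of `C(X)`
into the tracial ultrapower of `C[0,1]` (`compHom`) whose trace is `τ`. Lifts of this homomorphism
approximate `τ` (`IsCStarTraciallyStable.exists_tendsto_integral`).

*From states to paths.* By Gelfand duality a homomorphism `C(X) → C[0,1]` is composition with a path.
If `τ` is the average over one point from each of the given open sets, then a path that approximates
`τ` well enough spends a positive time in each of these sets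
(`isApproximatelyPathConnected_of_states`).

*From paths to stability.* Let `π` be a homomorphism of `C(X)` into a tracial ultraproduct. The limit
trace (`TracialUltraproduct.trace`) induces a probability measure `μ` on `X`, and the `2`-norm of
`π f` is the norm of `f` in `L²(μ)`. Paths that meet every ball of a fine finite cover yield
continuous maps `h n : X → [0,1]` and `γ n : [0,1] → X` with `γ n ∘ h n → id` almost everywhere
(`IsApproximatelyPathConnected.exists_ae_tendsto`). Hence `π` is a pointwise limit in `2`-norm of
homomorphisms that factor through `C[0,1]`. A homomorphism of `C[0,1]` into the ultraproduct is given
by one selfadjoint element, which has a selfadjoint lift, and functional calculus lifts the whole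
homomorphism (`TracialUltraproduct.exists_lift_unitInterval`). Nontriviality of the ultrafilter
permits a diagonal choice among these lifts (`Ultrafilter.IsNontrivial.exists_diagonal`).
-/

/-! ### States and tracial states -/

namespace IsState

theorem map_star {A : Type*} [CStarAlgebra A] {φ : A →ₗ[ℂ] ℂ} (hφ : IsState φ) (a : A) : φ (star a) = star (φ a) := by
  have h1 := (Complex.nonneg_iff.1 (hφ.nonneg (a + 1))).2
  have h2 := (Complex.nonneg_iff.1 (hφ.nonneg (a + Complex.I • 1))).2
  have h3 := (Complex.nonneg_iff.1 (hφ.nonneg a)).2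
  simp only [star_add, star_one, star_smul, mul_add, add_mul, mul_one, one_mul, map_add,
    hφ.map_one, mul_smul_comm, smul_mul_assoc, map_smul, smul_eq_mul, Complex.add_im,
    Complex.mul_im, Complex.I_re, Complex.I_im, Complex.one_im, RCLike.star_def,
    Complex.conj_I, Complex.neg_re, Complex.neg_im] at h1 h2
  apply Complex.ext
  · simp only [RCLike.star_def, Complex.conj_re]
    linarith
  · simp only [RCLike.star_def, Complex.conj_im]
    linarith

end IsState

namespace TracialState

variable {A : Type*} [CStarAlgebra A] (ρ : TracialState A)

/-- The Cauchy–Schwarz inequality, obtained by expanding `‖a - ρ a‖₂ ^ 2 ≥ 0`. -/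
theorem norm_apply_le_twoNorm (a : A) : ‖ρ.1 a‖ ≤ ρ.twoNorm a := by
  have h := (Complex.nonneg_iff.1 (ρ.2.nonneg (a - ρ.1 a • 1))).1
  simp only [star_sub, star_smul, star_one, mul_sub, sub_mul, mul_smul_comm, smul_mul_assoc,
    mul_one, one_mul, map_sub, map_smul, ρ.2.map_one, ρ.2.toIsState.map_star, smul_eq_mul,
    RCLike.star_def, Complex.sub_re, Complex.mul_re, Complex.conj_re, Complex.conj_im] at h
  refine Real.le_sqrt_of_sq_le ?_
  rw [Complex.sq_norm, Complex.normSq_apply]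
  linarith

theorem twoNorm_le_norm [Nontrivial A] (a : A) : ρ.twoNorm a ≤ ‖a‖ := by
  have h := ρ.twoNorm_mul_sq_le a 1
  have h1 : ρ.twoNorm 1 = 1 := by simp [twoNorm, ρ.2.map_one]
  rw [mul_one, h1, one_pow, mul_one] at h
  exact le_of_sq_le_sq h (norm_nonneg a)

end TracialState

/-! ### The limit trace of a tracial ultraproduct -/

namespace TracialUltraproduct

open Filter

variable {I : Type v} {B : I → Type w} [∀ i, CStarAlgebra (B i)] [∀ i, Nontrivial (B i)]
variable (α : Ultrafilter I) (ρ : ∀ i, TracialState (B i))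

theorem mk_add (a b : lp B ∞) : mk α ρ (a + b) = mk α ρ a + mk α ρ b := rfl

theorem mk_sub (a b : lp B ∞) : mk α ρ (a - b) = mk α ρ a - mk α ρ b := rfl

theorem mk_mul (a b : lp B ∞) : mk α ρ (a * b) = mk α ρ a * mk α ρ b := rfl

theorem mk_smul (c : ℂ) (a : lp B ∞) : mk α ρ (c • a) = c • mk α ρ a := rfl

theorem mk_eq_mk_iff {a b : lp B ∞} : mk α ρ a = mk α ρ b ↔
    Tendsto (fun i => (ρ i).twoNorm (a i - b i) ^ 2) α (𝓝 0) :=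
  Ideal.Quotient.eq.trans (mem_traceIdeal α ρ)

theorem exists_tendsto_of_bounded {f : I → ℂ} {C : ℝ} (hf : ∀ i, ‖f i‖ ≤ C) :
    ∃ z, Tendsto f α (𝓝 z) := by
  obtain ⟨z, -, hz⟩ := (isCompact_closedBall (0 : ℂ) C).ultrafilter_le_nhds (α.map f)
    (by
    refine le_principal_iff.2 (mem_map.2 (univ_mem' fun i => ?_))
    simpa using hf i)
  exact ⟨z, hz⟩

theorem norm_apply_le (a : lp B ∞) (i : I) : ‖(ρ i).1 (a i)‖ ≤ ‖a‖ :=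
  ((ρ i).norm_apply_le_twoNorm _).trans
    (((ρ i).twoNorm_le_norm _).trans (lp.norm_apply_le_norm ENNReal.top_ne_zero a i))

/-- The limit of the traces depends on the coset only. -/
theorem exists_tendsto (x : TracialUltraproduct α ρ) :
    ∃ z, ∀ a, mk α ρ a = x → Tendsto (fun i => (ρ i).1 (a i)) α (𝓝 z) := by
  obtain ⟨b, rfl⟩ := mk_surjective α ρ x
  obtain ⟨z, hz⟩ := exists_tendsto_of_bounded α (norm_apply_le ρ b)
  refine ⟨z, fun a ha => ?_⟩
  have h : Tendsto (fun i => (ρ i).1 (a i - b i)) α (𝓝 0) := by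
    have h := ((mk_eq_mk_iff α ρ).1 ha).sqrt
    rw [Real.sqrt_zero] at h
    refine squeeze_zero_norm (fun i => ?_) h
    exact ((ρ i).norm_apply_le_twoNorm _).trans (Real.le_sqrt_of_sq_le le_rfl)
  simpa using h.add hz

/-- The tracial state `{a i}_α ↦ lim_α ρ i (a i)` of a tracial ultraproduct. -/
noncomputable def trace : TracialUltraproduct α ρ →ₗ[ℂ] ℂ where
  toFun x := (exists_tendsto α ρ x).choose
  map_add' x y := by
    obtain ⟨a, rfl⟩ := mk_surjective α ρ x
    obtain ⟨b, rfl⟩ := mk_surjective α ρ y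
    refine tendsto_nhds_unique ((exists_tendsto α ρ _).choose_spec (a + b) rfl) ?_
    simpa using ((exists_tendsto α ρ _).choose_spec a rfl).add
      ((exists_tendsto α ρ _).choose_spec b rfl)
  map_smul' c x := by
    obtain ⟨a, rfl⟩ := mk_surjective α ρ x
    refine tendsto_nhds_unique ((exists_tendsto α ρ _).choose_spec (c • a) rfl) ?_
    simpa using ((exists_tendsto α ρ _).choose_spec a rfl).const_mul c

theorem tendsto_trace (a : lp B ∞) :
    Tendsto (fun i => (ρ i).1 (a i)) α (𝓝 (trace α ρ (mk α ρ a))) :=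
  (exists_tendsto α ρ _).choose_spec a rfl

theorem trace_one : trace α ρ 1 = 1 := by
  refine tendsto_nhds_unique (tendsto_trace α ρ 1) ?_
  simp [fun i => (ρ i).2.map_one]

theorem trace_star_mul_self_nonneg (x : TracialUltraproduct α ρ) :
    0 ≤ trace α ρ (star x * x) := by
  obtain ⟨a, rfl⟩ := mk_surjective α ρ x
  exact ge_of_tendsto' (tendsto_trace α ρ (star a * a)) fun i => (ρ i).2.nonneg (a i)

/-- The squared `2`-norm of an ultraproduct is the limit of the squared `2`-norms. -/
theorem tendsto_twoNorm_sq (a : lp B ∞) :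
    Tendsto (fun i => (ρ i).twoNorm (a i) ^ 2) α
      (𝓝 (trace α ρ (star (mk α ρ a) * mk α ρ a)).re) := by
  simp only [TracialState.twoNorm_sq]
  exact (Complex.continuous_re.tendsto _).comp (tendsto_trace α ρ (star a * a))

/-- Pulling the limit trace back along a unital ⋆-homomorphism gives a state. -/
theorem isState_comp {A : Type*} [CStarAlgebra A] (π : A →⋆ₐ[ℂ] TracialUltraproduct α ρ) :
    IsState (trace α ρ ∘ₗ π.toAlgHom.toLinearMap) where
  nonneg a := by
    simpa [map_star] using trace_star_mul_self_nonneg α ρ (π a)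
  map_one := by simp [trace_one]

end TracialUltraproduct

/-! ### States of `C(X)` are probability measures -/

section Riesz

open MeasureTheory

variable {X : Type*} [TopologicalSpace X]

/-- A real continuous function as a complex one. -/
def ContinuousMap.ofRealComp (f : C(X, ℝ)) : C(X, ℂ) := ⟨fun x => (f x : ℂ), by fun_prop⟩

theorem ContinuousMap.ofRealComp_apply (f : C(X, ℝ)) (x : X) : f.ofRealComp x = (f x : ℂ) := rfl

variable [CompactSpace X]

theorem IsState.nonneg_of_real {τ : C(X, ℂ) →ₗ[ℂ] ℂ} (hτ : IsState τ) (f : C(X, ℝ))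
    (hf : ∀ x, 0 ≤ f x) : 0 ≤ τ f.ofRealComp := by
  let g : C(X, ℝ) := ⟨fun x => Real.sqrt (f x), by fun_prop⟩
  have h : f.ofRealComp = star g.ofRealComp * g.ofRealComp := by
    ext x
    simp only [ContinuousMap.mul_apply, ContinuousMap.star_apply, ContinuousMap.ofRealComp_apply,
      RCLike.star_def, Complex.conj_ofReal, ← Complex.ofReal_mul]
    exact congrArg _ (Real.mul_self_sqrt (hf x)).symm
  rw [h]
  exact hτ.nonneg _

theorem IsState.real_of_real {τ : C(X, ℂ) →ₗ[ℂ] ℂ} (hτ : IsState τ) (f : C(X, ℝ)) :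
    τ f.ofRealComp = ((τ f.ofRealComp).re : ℂ) := by
  have h : star f.ofRealComp = f.ofRealComp := by
    ext x
    simp [ContinuousMap.ofRealComp_apply]
  have h2 := hτ.map_star f.ofRealComp
  rw [h] at h2
  exact (Complex.conj_eq_iff_re.1 h2.symm).symm

variable [T2Space X] [MeasurableSpace X] [BorelSpace X]

/-- The Riesz representation theorem for states of `C(X)`. -/
theorem IsState.exists_measure {τ : C(X, ℂ) →ₗ[ℂ] ℂ} (hτ : IsState τ) :
    ∃ μ : Measure X, IsProbabilityMeasure μ ∧ ∀ f, τ f = ∫ x, f x ∂μ := by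
  let L : CompactlySupportedContinuousMap X ℝ →ₗ[ℝ] ℝ :=
    { toFun := fun f => (τ f.toContinuousMap.ofRealComp).re
      map_add' := fun f g => by
        rw [← Complex.add_re, ← map_add]
        congr 2
        ext x
        exact Complex.ofReal_add _ _
      map_smul' := fun c f => by
        have : (c • f).toContinuousMap.ofRealComp = (c : ℂ) • f.toContinuousMap.ofRealComp := by
          ext x
          exact Complex.ofReal_mul _ _
        rw [this, map_smul]
        simp }
  let Λ : CompactlySupportedContinuousMap X ℝ →ₚ[ℝ] ℝ := PositiveLinearMap.mk₀ L fun f hf =>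
    (Complex.nonneg_iff.1 (hτ.nonneg_of_real f.toContinuousMap hf)).1
  let μ := RealRMK.rieszMeasure Λ
  have key : ∀ f : C(X, ℝ), τ f.ofRealComp = ((∫ x, f x ∂μ : ℝ) : ℂ) := fun f => by
    rw [hτ.real_of_real]
    exact congrArg _ (RealRMK.integral_rieszMeasure Λ
      ⟨f, HasCompactSupport.of_compactSpace f⟩).symm
  have hμ : IsProbabilityMeasure μ := by
    have h1 : (1 : C(X, ℝ)).ofRealComp = 1 := by
      ext x
      simp [ContinuousMap.ofRealComp_apply]
    have h := key 1
    rw [h1, hτ.map_one] at h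
    simp only [ContinuousMap.one_apply, integral_const, smul_eq_mul, mul_one] at h
    exact ⟨(ENNReal.toReal_eq_one_iff _).1 (by exact_mod_cast h.symm)⟩
  refine ⟨μ, hμ, fun f => ?_⟩
  let fr : C(X, ℝ) := ⟨fun x => (f x).re, by fun_prop⟩
  let fi : C(X, ℝ) := ⟨fun x => (f x).im, by fun_prop⟩
  have hf : f = fr.ofRealComp + Complex.I • fi.ofRealComp := by
    ext x
    rw [ContinuousMap.add_apply, ContinuousMap.smul_apply, smul_eq_mul, mul_comm]
    exact (Complex.re_add_im (f x)).symm
  have hint : Integrable f μ := f.continuous.integrable_of_hasCompactSupport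
    (HasCompactSupport.of_compactSpace f)
  conv_lhs => rw [hf]
  rw [map_add, map_smul, key, key, ← integral_re_add_im hint, smul_eq_mul, mul_comm]
  rfl

end Riesz

open Filter in
/-- Convergence to `0` of uniformly controlled functions need only be checked on a dense sequence.
The control is asymptotic only, as is natural for `2`-norms in an ultraproduct. -/
theorem tendsto_zero_of_denseRange {E ι : Type*} [PseudoMetricSpace E] {l : Filter ι} {e : ℕ → E}
    (he : DenseRange e) {d : ι → E → ℝ} (h0 : ∀ i x, 0 ≤ d i x) {C : ℝ}
    (hd : ∀ x, ∀ ε > 0, ∃ δ > 0, ∀ y, dist x y < δ → ∀ᶠ i in l, d i x ≤ C * d i y + ε)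
    (hlim : ∀ k, Tendsto (fun i => d i (e k)) l (𝓝 0)) (x : E) :
    Tendsto (fun i => d i x) l (𝓝 0) := by
  refine tendsto_order.2 ⟨fun a ha => Eventually.of_forall fun i => ha.trans_le (h0 i x),
    fun ε hε => ?_⟩
  obtain ⟨δ, hδ, h⟩ := hd x (ε / 2) (half_pos hε)
  obtain ⟨k, hk⟩ := he.exists_dist_lt x hδ
  have h2 := (hlim k).const_mul C
  rw [mul_zero] at h2
  filter_upwards [h _ hk, h2.eventually_lt_const (half_pos hε)] with i h1 h3
  linarith

/-! ### From states to paths -/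

section Paths

variable {X : Type*} [TopologicalSpace X] [CompactSpace X] [T2Space X]
  {Y : Type*} [TopologicalSpace Y] [CompactSpace Y]

open WeakDual.CharacterSpace in
/-- Gelfand duality on morphisms. -/
theorem ContinuousMap.exists_comp_eq (φ : C(X, ℂ) →⋆ₐ[ℂ] C(Y, ℂ)) :
    ∃ γ : C(Y, X), ∀ f y, φ f y = f (γ y) := by
  refine ⟨((homeoEval X ℂ).symm : C(_, X)).comp
    ((compContinuousMap φ).comp (continuousMapEval Y ℂ)), fun f y => ?_⟩
  change φ f y = f ((homeoEval X ℂ).symm _)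
  exact congrArg (fun χ : WeakDual.characterSpace ℂ C(X, ℂ) => χ f)
    ((homeoEval X ℂ).apply_symm_apply (compContinuousMap φ (continuousMapEval Y ℂ y))).symm

end Paths

/-- The state averaging the values at finitely many points. -/
theorem isState_average {X : Type*} [TopologicalSpace X] [CompactSpace X] {s : ℕ} (hs : 1 ≤ s)
    (x : Fin s → X) : IsState
      ((s : ℂ)⁻¹ • ∑ k, (ContinuousMap.evalStarAlgHom ℂ ℂ (x k)).toAlgHom.toLinearMap) where
  nonneg f := by
    simp only [LinearMap.smul_apply, LinearMap.sum_apply, smul_eq_mul]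
    refine mul_nonneg ?_ (Finset.sum_nonneg fun k _ => ?_)
    · rw [inv_nonneg]
      exact_mod_cast s.zero_le
    · exact star_mul_self_nonneg (f (x k))
  map_one := by
    have : (s : ℂ) ≠ 0 := by exact_mod_cast (by omega : s ≠ 0)
    simp [this]

open MeasureTheory Filter in
/-- Given a point in each of finitely many open sets, paths whose Lebesgue distributions tend to the
uniform measure on these points eventually meet all the open sets. -/
theorem isApproximatelyPathConnected_of_states {X : Type u} [MetricSpace X] [CompactSpace X]
    (h : ∀ τ : C(X, ℂ) →ₗ[ℂ] ℂ, IsState τ →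
      ∃ π : ℕ → (C(X, ℂ) →⋆ₐ[ℂ] C(unitInterval, ℂ)), ∀ f : C(X, ℂ),
        Tendsto (fun n => ∫ x : unitInterval, π n f x) atTop (𝓝 (τ f))) :
    IsApproximatelyPathConnected X := by
  intro s hs V hV
  choose x hx using fun k => (hV k).2
  choose r hr hrV using fun k => Metric.isOpen_iff.1 (hV k).1 (x k) (hx k)
  -- bump functions `f k`, supported in `V k` and positive at `x k`
  let f : Fin s → C(X, ℝ) := fun k => ⟨fun y => max 0 (r k - dist y (x k)), by fun_prop⟩
  have hf0 : ∀ k y, 0 ≤ f k y := fun k y => le_max_left _ _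
  have hfV : ∀ k y, f k y ≠ 0 → y ∈ V k := fun k y hy => by
    refine hrV k (Metric.mem_ball.2 ?_)
    by_contra! hd
    exact hy (max_eq_left (by linarith))
  have hfx : ∀ k, 0 < f k (x k) := fun k => by simpa [f] using hr k
  obtain ⟨π, hπ⟩ := h _ (isState_average hs x)
  have hne : ∀ k, ∀ᶠ n in atTop, ∫ t : unitInterval, π n (f k).ofRealComp t ≠ 0 := fun k => by
    refine (hπ _).eventually_ne ?_
    have hs' : (s : ℂ) ≠ 0 := by exact_mod_cast (by omega : s ≠ 0)
    have h1 : 0 < ∑ j, f k (x j) :=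
      (hfx k).trans_le (Finset.single_le_sum (fun j _ => hf0 k (x j)) (Finset.mem_univ k))
    simp only [LinearMap.smul_apply, LinearMap.sum_apply, smul_eq_mul]
    refine mul_ne_zero (inv_ne_zero hs') ?_
    change ∑ j, ((f k (x j) : ℝ) : ℂ) ≠ 0
    exact_mod_cast h1.ne'
  obtain ⟨n, hn⟩ := (eventually_all.2 hne).exists
  obtain ⟨γ, hγ⟩ := ContinuousMap.exists_comp_eq (π n)
  refine ⟨γ, fun k => ?_⟩
  obtain ⟨t, ht⟩ : ∃ t, f k (γ t) ≠ 0 := by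
    by_contra! hc
    refine hn k ?_
    simp [hγ, ContinuousMap.ofRealComp_apply, hc]
  have hopen : IsOpen {t | f k (γ t) ≠ 0} :=
    isOpen_ne_fun ((f k).continuous.comp γ.continuous) continuous_const
  have hdense : Dense (Set.Ioo (0 : unitInterval) 1) := by
    rw [dense_iff_closure_eq, closure_Ioo zero_ne_one]
    exact Set.eq_univ_of_forall fun t => ⟨t.2.1, t.2.2⟩
  obtain ⟨t', ht', ht'I⟩ := hdense.inter_open_nonempty _ hopen ⟨t, ht⟩
  exact ⟨γ t', ⟨t', ht'I, rfl⟩, hfV k _ ht'⟩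

/-! ### Smoothing by moving averages -/

section MovingAverage

open MeasureTheory Filter

/-- The average of `F` over the interval `[t, t + 1/(n+1)]`. -/
noncomputable def movingAverage (n : ℕ) (F : ℝ → ℂ) (t : ℝ) : ℂ :=
  ((n : ℝ) + 1) • ∫ s in t..(t + ((n : ℝ) + 1)⁻¹), F s

theorem locallyIntegrable_of_bounded {F : ℝ → ℂ} (hF : Measurable F) {C : ℝ}
    (hC : ∀ t, ‖F t‖ ≤ C) : LocallyIntegrable F := by
  refine (locallyIntegrable_const C).mono hF.aestronglyMeasurable (Eventually.of_forall fun t => ?_)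
  exact (hC t).trans (le_abs_self C)

theorem norm_movingAverage_le {F : ℝ → ℂ} {C : ℝ} (hC : ∀ t, ‖F t‖ ≤ C) (n : ℕ) (t : ℝ) :
    ‖movingAverage n F t‖ ≤ C := by
  have hn : (0 : ℝ) < n + 1 := by positivity
  have h := intervalIntegral.norm_integral_le_of_norm_le_const (a := t)
    (b := t + ((n : ℝ) + 1)⁻¹) (fun s _ => hC s)
  rw [add_sub_cancel_left, abs_of_pos (inv_pos.2 hn)] at h
  rw [movingAverage, norm_smul, Real.norm_of_nonneg hn.le]
  calc _ ≤ ((n : ℝ) + 1) * (C * ((n : ℝ) + 1)⁻¹) := by gcongr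
    _ = C := by field_simp

theorem intervalIntegrable_of_locallyIntegrable {F : ℝ → ℂ} (hF : LocallyIntegrable F) (a b : ℝ) :
    IntervalIntegrable F volume a b :=
  (hF.integrableOn_isCompact isCompact_uIcc).intervalIntegrable

theorem movingAverage_eq_sub {F : ℝ → ℂ} (hF : LocallyIntegrable F) (n : ℕ) (t : ℝ) :
    movingAverage n F t = ((n : ℝ) + 1) •
      ((∫ s in (0 : ℝ)..(t + ((n : ℝ) + 1)⁻¹), F s) - ∫ s in (0 : ℝ)..t, F s) := by
  have hi := intervalIntegrable_of_locallyIntegrable hF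
  rw [movingAverage, intervalIntegral.integral_interval_sub_left (hi _ _) (hi _ _)]

theorem continuous_movingAverage {F : ℝ → ℂ} (hF : LocallyIntegrable F) (n : ℕ) :
    Continuous (movingAverage n F) := by
  have hc := intervalIntegral.continuous_primitive (intervalIntegrable_of_locallyIntegrable hF) (0 : ℝ)
  rw [funext (movingAverage_eq_sub hF n)]
  exact Continuous.const_smul ((hc.comp (continuous_id.add continuous_const)).sub hc) ((n : ℝ) + 1)

/-- Lebesgue's differentiation theorem for moving averages. -/
theorem ae_tendsto_movingAverage {F : ℝ → ℂ} (hF : LocallyIntegrable F) :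
    ∀ᵐ t, Tendsto (fun n => movingAverage n F t) atTop (𝓝 (F t)) := by
  filter_upwards [_root_.LocallyIntegrable.ae_hasDerivAt_integral hF] with t ht
  have h1 : Tendsto (fun n : ℕ => ((n : ℝ) + 1)⁻¹) atTop (𝓝[≠] 0) := by
    refine tendsto_nhdsWithin_iff.2 ⟨?_, Eventually.of_forall fun n => ?_⟩
    · simpa using tendsto_one_div_add_atTop_nhds_zero_nat (𝕜 := ℝ)
    · exact inv_ne_zero (by positivity)
  refine ((ht 0).tendsto_slope_zero.comp h1).congr fun n => ?_
  rw [movingAverage_eq_sub hF]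
  simp

end MovingAverage

/-! ### Realizing a state in a tracial ultrapower of `C[0,1]` -/

section IntervalUltrapower

open MeasureTheory Filter

theorem integrable_comp_up (c : C(ULift.{w} unitInterval, ℂ)) :
    Integrable fun t : unitInterval => c ⟨t⟩ :=
  (c.continuous.comp continuous_uliftUp).integrable_of_hasCompactSupport
    (HasCompactSupport.of_compactSpace _)

/-- Integration against Lebesgue measure, as a tracial state of `C[0,1]`; lifting `[0,1]` puts the
algebra into an arbitrary universe. -/
noncomputable def lebesgueTrace : TracialState C(ULift.{w} unitInterval, ℂ) where
  val :=
    { toFun := fun c => ∫ t : unitInterval, c ⟨t⟩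
      map_add' := fun c d => integral_add (integrable_comp_up c) (integrable_comp_up d)
      map_smul' := fun z c => integral_const_mul z _ }
  property :=
    { nonneg := fun c => by
        have h : ∀ t : unitInterval, (star c * c) ⟨t⟩ = ((‖c ⟨t⟩‖ ^ 2 : ℝ) : ℂ) := fun t => by
          rw [ContinuousMap.mul_apply, ContinuousMap.star_apply, RCLike.star_def,
            Complex.conj_mul']
          norm_cast
        change 0 ≤ ∫ t : unitInterval, (star c * c) ⟨t⟩
        simp_rw [h]
        rw [integral_complex_ofReal]
        exact_mod_cast integral_nonneg fun t => sq_nonneg _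
      map_one := by simp
      mul_comm := fun c d => by rw [mul_comm] }

theorem lebesgueTrace_apply (c : C(ULift.{w} unitInterval, ℂ)) :
    lebesgueTrace.1 c = ∫ t : unitInterval, c ⟨t⟩ := rfl

theorem lebesgueTrace_twoNorm_sq (c : C(ULift.{w} unitInterval, ℂ)) :
    lebesgueTrace.twoNorm c ^ 2 = ∫ t : unitInterval, ‖c ⟨t⟩‖ ^ 2 := by
  have h : ∀ t : unitInterval, (star c * c) ⟨t⟩ = ((‖c ⟨t⟩‖ ^ 2 : ℝ) : ℂ) := fun t => by
    rw [ContinuousMap.mul_apply, ContinuousMap.star_apply, RCLike.star_def, Complex.conj_mul']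
    norm_cast
  rw [TracialState.twoNorm_sq, lebesgueTrace_apply]
  simp_rw [h]
  rw [integral_complex_ofReal, Complex.ofReal_re]

/-- A nontrivial ultrafilter on a copy of `ℕ` in an arbitrary universe. -/
noncomputable def natUltrafilter : Ultrafilter (ULift.{v} ℕ) := hyperfilter _

theorem tendsto_down_natUltrafilter : Tendsto ULift.down (natUltrafilter.{v} : Filter (ULift.{v} ℕ)) atTop := by
  rw [← Nat.cofinite_eq_atTop]
  exact ULift.down_injective.tendsto_cofinite.mono_left hyperfilter_le_cofinite

theorem natUltrafilter_isNontrivial : natUltrafilter.{v}.IsNontrivial := by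
  refine ⟨fun n => {i | n ≤ i.down},
    fun n => tendsto_down_natUltrafilter.eventually (eventually_ge_atTop n), ?_⟩
  refine Set.eq_empty_of_forall_notMem fun i hi => ?_
  exact absurd (Set.mem_iInter.1 hi (i.down + 1)) (by simp)

set_option linter.checkUnivs false in
/-- The C⋆-product of countably many copies of `C[0,1]`. -/
abbrev IntervalProduct : Type (max v w) :=
  lp (fun _ : ULift.{v} ℕ => C(ULift.{w} unitInterval, ℂ)) ∞

set_option linter.checkUnivs false in
/-- The tracial ultrapower of `C[0,1]` with Lebesgue measure. -/
abbrev IntervalUltrapower : Type (max v w) :=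
  TracialUltraproduct natUltrafilter.{v} fun _ => lebesgueTrace.{w}

theorem norm_apply_apply_le (a : IntervalProduct.{v, w}) (i : ULift ℕ) (t) : ‖a i t‖ ≤ ‖a‖ :=
  ((a i).norm_coe_le_norm t).trans (lp.norm_apply_le_norm ENNReal.top_ne_zero a i)

/-- Bounded sequences in `C[0,1]` with the same limit almost everywhere have the same coset. -/
theorem mk_eq_mk_of_ae_tendsto {a b : IntervalProduct.{v, w}} {F : unitInterval → ℂ}
    (ha : ∀ᵐ t, Tendsto (fun n : ℕ => a ⟨n⟩ ⟨t⟩) atTop (𝓝 (F t)))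
    (hb : ∀ᵐ t, Tendsto (fun n : ℕ => b ⟨n⟩ ⟨t⟩) atTop (𝓝 (F t))) :
    (TracialUltraproduct.mk _ _ a : IntervalUltrapower) = TracialUltraproduct.mk _ _ b := by
  rw [TracialUltraproduct.mk_eq_mk_iff]
  have h : Tendsto (fun n : ℕ => ∫ t : unitInterval, ‖a ⟨n⟩ ⟨t⟩ - b ⟨n⟩ ⟨t⟩‖ ^ 2) atTop
      (𝓝 (∫ _ : unitInterval, (0 : ℝ))) := by
    refine tendsto_integral_of_dominated_convergence (fun _ => (‖a‖ + ‖b‖) ^ 2)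
      (fun n => ?_) (integrable_const _) (fun n => ?_) ?_
    · have h := (((a ⟨n⟩ - b ⟨n⟩).continuous.comp continuous_uliftUp).norm.pow 2)
      exact h.aestronglyMeasurable
    · refine Eventually.of_forall fun t => ?_
      rw [norm_pow, norm_norm]
      gcongr
      exact (norm_sub_le _ _).trans
        (add_le_add (norm_apply_apply_le a _ _) (norm_apply_apply_le b _ _))
    · filter_upwards [ha, hb] with t h1 h2
      simpa using ((h1.sub h2).norm.pow 2)
  rw [integral_zero] at h
  simp only [lebesgueTrace_twoNorm_sq]
  exact h.comp tendsto_down_natUltrafilter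

theorem trace_mk_of_ae_tendsto {a : IntervalProduct.{v, w}} {F : unitInterval → ℂ}
    (ha : ∀ᵐ t, Tendsto (fun n : ℕ => a ⟨n⟩ ⟨t⟩) atTop (𝓝 (F t))) :
    TracialUltraproduct.trace natUltrafilter.{v} (fun _ => lebesgueTrace.{w})
      (TracialUltraproduct.mk _ _ a) = ∫ t : unitInterval, F t := by
  refine tendsto_nhds_unique (TracialUltraproduct.tendsto_trace _ _ a) ?_
  have h : Tendsto (fun n : ℕ => ∫ t : unitInterval, a ⟨n⟩ ⟨t⟩) atTop
      (𝓝 (∫ t : unitInterval, F t)) :=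
    tendsto_integral_of_dominated_convergence (fun _ => ‖a‖)
      (fun n => (integrable_comp_up (a ⟨n⟩)).aestronglyMeasurable) (integrable_const _)
      (fun n => Eventually.of_forall fun t => norm_apply_apply_le a _ _) ha
  exact h.comp tendsto_down_natUltrafilter

variable {X : Type u} [MetricSpace X] [CompactSpace X] [MeasurableSpace X] [BorelSpace X]

/-- The function `f ∘ g` on `[0,1]`, extended to the real line by its values at the end points. -/
noncomputable def extendComp (g : unitInterval → X) (f : C(X, ℂ)) (s : ℝ) : ℂ :=
  f (g (Set.projIcc 0 1 zero_le_one s))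

theorem locallyIntegrable_extendComp {g : unitInterval → X} (hg : Measurable g) (f : C(X, ℂ)) :
    LocallyIntegrable (extendComp g f) :=
  locallyIntegrable_of_bounded
    (f.continuous.measurable.comp (hg.comp continuous_projIcc.measurable))
    fun _ => f.norm_coe_le_norm _

/-- The sequence of moving averages of `f ∘ g`. -/
noncomputable def averages {g : unitInterval → X} (hg : Measurable g) (f : C(X, ℂ)) :
    IntervalProduct.{v, w} :=
  ⟨fun i => ⟨fun t => movingAverage i.down (extendComp g f) t.down,
      (continuous_movingAverage (locallyIntegrable_extendComp hg f) _).comp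
        (continuous_subtype_val.comp continuous_uliftDown)⟩,
    memℓp_infty ⟨‖f‖, by
      rintro _ ⟨i, rfl⟩
      refine (ContinuousMap.norm_le _ (norm_nonneg f)).2 fun t => ?_
      exact norm_movingAverage_le (fun _ => f.norm_coe_le_norm _) _ _⟩⟩

theorem ae_tendsto_averages {g : unitInterval → X} (hg : Measurable g) (f : C(X, ℂ)) :
    ∀ᵐ t, Tendsto (fun n : ℕ => averages.{u, v, w} hg f ⟨n⟩ ⟨t⟩) atTop (𝓝 (f (g t))) := by
  have h := ae_tendsto_movingAverage (locallyIntegrable_extendComp hg f)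
  have h2 := unitInterval.measurePreserving_coe.quasiMeasurePreserving.ae (ae_restrict_of_ae h)
  filter_upwards [h2] with t ht
  simpa [extendComp, averages] using ht

/-- The unital ⋆-homomorphism `C(X) → L^∞[0,1]`, `f ↦ f ∘ g`, in its realization inside the tracial
ultrapower of `C[0,1]`. All algebraic identities hold because both sides have the same limit almost
everywhere. -/
noncomputable def compHom {g : unitInterval → X} (hg : Measurable g) :
    C(X, ℂ) →⋆ₐ[ℂ] IntervalUltrapower.{v, w} where
  toFun f := TracialUltraproduct.mk _ _ (averages.{u, v, w} hg f)
  map_one' := mk_eq_mk_of_ae_tendsto (b := 1) (ae_tendsto_averages.{u, v, w} hg 1)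
    (Eventually.of_forall fun t => tendsto_const_nhds)
  map_zero' := mk_eq_mk_of_ae_tendsto (b := 0) (ae_tendsto_averages.{u, v, w} hg 0)
    (Eventually.of_forall fun t => tendsto_const_nhds)
  map_mul' f f' := mk_eq_mk_of_ae_tendsto (b := averages.{u, v, w} hg f * averages.{u, v, w} hg f')
    (ae_tendsto_averages.{u, v, w} hg (f * f')) <| by
      filter_upwards [ae_tendsto_averages.{u, v, w} hg f, ae_tendsto_averages.{u, v, w} hg f'] with t h1 h2
      exact h1.mul h2
  map_add' f f' := mk_eq_mk_of_ae_tendsto (b := averages.{u, v, w} hg f + averages.{u, v, w} hg f')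
    (ae_tendsto_averages.{u, v, w} hg (f + f')) <| by
      filter_upwards [ae_tendsto_averages.{u, v, w} hg f, ae_tendsto_averages.{u, v, w} hg f'] with t h1 h2
      exact h1.add h2
  commutes' z := mk_eq_mk_of_ae_tendsto (b := algebraMap ℂ _ z)
    (ae_tendsto_averages.{u, v, w} hg (algebraMap ℂ _ z))
    (Eventually.of_forall fun t => tendsto_const_nhds)
  map_star' f := mk_eq_mk_of_ae_tendsto (b := star (averages.{u, v, w} hg f))
    (ae_tendsto_averages.{u, v, w} hg (star f)) <| by
      filter_upwards [ae_tendsto_averages.{u, v, w} hg f] with t h1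
      exact (continuous_star.tendsto _).comp h1

end IntervalUltrapower

/-! ### From stability to states -/

section Stability

open MeasureTheory Filter

theorem IsState.norm_apply_le {X : Type*} [TopologicalSpace X] [CompactSpace X] [T2Space X]
    {τ : C(X, ℂ) →ₗ[ℂ] ℂ} (hτ : IsState τ) (f : C(X, ℂ)) : ‖τ f‖ ≤ ‖f‖ := by
  let _ : MeasurableSpace X := borel X
  have : BorelSpace X := ⟨rfl⟩
  obtain ⟨μ, hμ, h⟩ := hτ.exists_measure
  rw [h]
  simpa using norm_integral_le_of_norm_le_const (μ := μ)
    (Eventually.of_forall fun x => f.norm_coe_le_norm x)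

theorem norm_integral_hom_le {X : Type*} [TopologicalSpace X] [CompactSpace X]
    (φ : C(X, ℂ) →⋆ₐ[ℂ] C(unitInterval, ℂ)) (f : C(X, ℂ)) :
    ‖∫ t : unitInterval, φ f t‖ ≤ ‖f‖ := by
  simpa using norm_integral_le_of_norm_le_const (μ := (volume : Measure unitInterval))
    (Eventually.of_forall fun t =>
      ((φ f).norm_coe_le_norm t).trans (NonUnitalStarAlgHom.norm_apply_le φ f))

/-- Represent `τ` as the distribution of a measurable `g : [0,1] → X`. Stability lifts the
homomorphism `f ↦ f ∘ g` into the ultrapower of `C[0,1]`, whose trace is `τ`; the lifts then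
approximate `τ` along an ultrafilter, and separability of `C(X)` extracts a sequence. -/
theorem IsCStarTraciallyStable.exists_tendsto_integral {X : Type u} [MetricSpace X] [CompactSpace X]
    (hX : IsCStarTraciallyStable.{u, v, w} C(X, ℂ)) (τ : C(X, ℂ) →ₗ[ℂ] ℂ) (hτ : IsState τ) :
    ∃ π : ℕ → (C(X, ℂ) →⋆ₐ[ℂ] C(unitInterval, ℂ)), ∀ f : C(X, ℂ),
      Tendsto (fun n => ∫ x : unitInterval, π n f x) atTop (𝓝 (τ f)) := by
  let _ : MeasurableSpace X := borel X
  have : BorelSpace X := ⟨rfl⟩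
  obtain ⟨μ, hμ, hτμ⟩ := hτ.exists_measure
  have : Nonempty X := nonempty_of_isProbabilityMeasure μ
  obtain ⟨g, hg, hgμ⟩ := μ.exists_measurable_map_eq
  obtain ⟨E, hE, φ, hφ⟩ := hX _ natUltrafilter.{v} natUltrafilter_isNontrivial
    (fun _ => C(ULift.{w} unitInterval, ℂ)) (fun _ => lebesgueTrace) (compHom hg)
  -- the homomorphisms provided by stability, with values in `C[0,1]` proper
  let up : C(unitInterval, ULift.{w} unitInterval) := ⟨ULift.up, continuous_uliftUp⟩
  let ψ : E → (C(X, ℂ) →⋆ₐ[ℂ] C(unitInterval, ℂ)) := fun i => (up.compStarAlgHom' ℂ ℂ).comp (φ i)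
  have hlim : ∀ f : C(X, ℂ), Tendsto (fun i => lebesgueTrace.1
      (extendByZero (B := fun _ => C(ULift.{w} unitInterval, ℂ)) E φ f i))
      natUltrafilter (𝓝 (τ f)) := fun f => by
    have h := TracialUltraproduct.tendsto_trace natUltrafilter (fun _ => lebesgueTrace.{w})
      (extendByZero E φ f)
    rw [← hφ f] at h
    have h2 : τ f = TracialUltraproduct.trace natUltrafilter (fun _ => lebesgueTrace.{w})
        (compHom hg f) := by
      refine Eq.trans ?_ (trace_mk_of_ae_tendsto (ae_tendsto_averages hg f)).symm
      rw [hτμ, ← hgμ, integral_map hg.aemeasurable f.continuous.aestronglyMeasurable]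
    rwa [h2]
  let e := TopologicalSpace.denseSeq C(X, ℂ)
  have hex : ∀ n : ℕ, ∃ σ : C(X, ℂ) →⋆ₐ[ℂ] C(unitInterval, ℂ),
      ∀ k ≤ n, ‖(∫ t : unitInterval, σ (e k) t) - τ (e k)‖ < ((n : ℝ) + 1)⁻¹ := fun n => by
    have h : ∀ᶠ i in (natUltrafilter : Filter _), ∀ k ∈ Set.Iic n,
        ‖lebesgueTrace.1 (extendByZero (B := fun _ => C(ULift.{w} unitInterval, ℂ)) E φ (e k) i)
          - τ (e k)‖ < ((n : ℝ) + 1)⁻¹ := by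
      refine (eventually_all_finite (Set.finite_Iic n)).2 fun k _ => ?_
      have h := ((hlim (e k)).sub_const (τ (e k))).norm
      rw [sub_self, norm_zero] at h
      exact h.eventually_lt_const (by positivity)
    obtain ⟨i, hi, hiE⟩ := (h.and hE).exists
    refine ⟨ψ ⟨i, hiE⟩, fun k hk => ?_⟩
    have h1 := hi k hk
    have h2 : extendByZero (B := fun _ => C(ULift.{w} unitInterval, ℂ)) E φ (e k) i = φ ⟨i, hiE⟩ (e k) :=
      dif_pos hiE
    rw [h2] at h1
    exact h1
  choose π hπ using hex
  refine ⟨π, fun f => ?_⟩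
  rw [tendsto_iff_norm_sub_tendsto_zero]
  refine tendsto_zero_of_denseRange (TopologicalSpace.denseRange_denseSeq C(X, ℂ)) (C := 1)
    (d := fun n f => ‖(∫ t : unitInterval, π n f t) - τ f‖) (fun n f => norm_nonneg _)
    (fun f ε hε => ⟨ε / 2, half_pos hε, fun f' hf' => Eventually.of_forall fun n => ?_⟩)
    (fun k => ?_) f
  · have hint : ∀ c : C(unitInterval, ℂ), Integrable c := fun c =>
      c.continuous.integrable_of_hasCompactSupport (HasCompactSupport.of_compactSpace _)
    have h1 := norm_integral_hom_le (π n) (f - f')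
    have h2 := hτ.norm_apply_le (f - f')
    have h3 : (∫ t : unitInterval, π n f t) - τ f = ((∫ t : unitInterval, π n f' t) - τ f') +
        ((∫ t : unitInterval, π n (f - f') t) - τ (f - f')) := by
      rw [map_sub, map_sub]
      simp only [ContinuousMap.sub_apply]
      rw [integral_sub (hint _) (hint _)]
      ring
    rw [dist_eq_norm] at hf'
    rw [h3]
    have h4 := norm_add_le ((∫ t : unitInterval, π n f' t) - τ f')
        ((∫ t : unitInterval, π n (f - f') t) - τ (f - f'))
    have h5 := norm_sub_le (∫ t : unitInterval, π n (f - f') t) (τ (f - f'))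
    linarith
  · refine squeeze_zero' (Eventually.of_forall fun n => norm_nonneg _)
      ((eventually_ge_atTop k).mono fun n hn => (hπ n k hn).le) ?_
    simpa using tendsto_one_div_add_atTop_nhds_zero_nat (𝕜 := ℝ)

end Stability

/-! ### Factoring the identity through `[0,1]` almost everywhere -/

section Factorization

open MeasureTheory Filter unitInterval

variable {X : Type u} [MetricSpace X] [CompactSpace X] [MeasurableSpace X] [BorelSpace X]

/-- In an approximately path-connected space the identity factors through `[0,1]` up to a small
error in measure: a path meets all balls of a finite cover, so that some measurable
`u : X → [0,1]` makes `γ ∘ u` uniformly close to the identity, and `u` is close in measure to a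
continuous map. -/
theorem IsApproximatelyPathConnected.exists_measureReal_le (hX : IsApproximatelyPathConnected X)
    (μ : Measure X) [IsProbabilityMeasure μ] {δ : ℝ} (hδ : 0 < δ) :
    ∃ (γ : C(I, X)) (h : C(X, I)), μ.real {x | δ ≤ dist (γ (h x)) x} ≤ δ := by
  classical
  have : Nonempty X := nonempty_of_isProbabilityMeasure μ
  obtain ⟨t, -, htf, ht⟩ := (isCompact_univ (X := X)).finite_cover_balls (e := δ / 4) (by linarith)
  have : Fintype t := htf.fintype
  have hcard : 1 ≤ Fintype.card t := by
    obtain ⟨x, hx, -⟩ := Set.mem_iUnion₂.1 (ht (Set.mem_univ (Classical.arbitrary X)))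
    exact Fintype.card_pos_iff.2 ⟨⟨x, hx⟩⟩
  let c := (Fintype.equivFin t).symm
  obtain ⟨γ, hγ⟩ := hX _ hcard (fun k => Metric.ball (c k : X) (δ / 4))
    fun k => ⟨Metric.isOpen_ball, ⟨_, Metric.mem_ball_self (by linarith)⟩⟩
  choose y hy hyball using hγ
  choose s hs hsy using hy
  -- a measurable choice of a parameter `s k` at which the path is near a given point
  let s' : ℕ → I := fun k => if hk : k < Fintype.card t then s ⟨k, hk⟩ else 0
  have hp : ∀ x, ∃ k, dist (γ (s' k)) x < δ / 2 := fun x => by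
    obtain ⟨z, hz, hxz⟩ := Set.mem_iUnion₂.1 (ht (Set.mem_univ x))
    obtain ⟨k, hk⟩ : ∃ k, c k = ⟨z, hz⟩ := c.surjective _
    refine ⟨k, ?_⟩
    have h1 : s' k = s k := dif_pos k.2
    have h2 := hyball k
    rw [hk, Metric.mem_ball] at h2
    rw [h1, hsy]
    rw [Metric.mem_ball, dist_comm] at hxz
    have := dist_triangle (y k) z x
    linarith
  let u : X → I := fun x => s' (Nat.find (hp x))
  have hu : Measurable u := (measurable_of_countable s').comp (measurable_find hp fun k =>
    (isOpen_lt (continuous_const.dist continuous_id) continuous_const).measurableSet)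
  have huγ : ∀ x, dist (γ (u x)) x < δ / 2 := fun x => Nat.find_spec (hp x)
  obtain ⟨η, hη, hγη⟩ := Metric.uniformContinuous_iff.1
    (CompactSpace.uniformContinuous_of_continuous γ.continuous) (δ / 2) (half_pos hδ)
  have hint : Integrable (fun x => (u x : ℝ)) μ :=
    Integrable.of_bound (measurable_subtype_coe.comp hu).aestronglyMeasurable 1
      (Eventually.of_forall fun x => by
        rw [Real.norm_of_nonneg (u x).2.1]
        exact (u x).2.2)
  obtain ⟨g, hg, hgint⟩ := hint.exists_boundedContinuous_integral_sub_le (mul_pos hη hδ)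
  refine ⟨γ, ⟨fun x => Set.projIcc 0 1 zero_le_one (g x), continuous_projIcc.comp g.continuous⟩, ?_⟩
  have hsub : {x | δ ≤ dist (γ (Set.projIcc 0 1 zero_le_one (g x))) x} ⊆
      {x | η ≤ ‖(u x : ℝ) - g x‖} := fun x hx => by
    change δ ≤ _ at hx
    change η ≤ _
    by_contra! hlt
    have h1 : dist (Set.projIcc 0 1 zero_le_one (g x)) (u x) < η := by
      rw [Subtype.dist_eq, Real.dist_eq, abs_sub_comm]
      have h := Set.abs_projIcc_sub_projIcc (zero_le_one (α := ℝ)) (c := (u x : ℝ)) (d := g x)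
      rw [Set.projIcc_val] at h
      exact h.trans_lt hlt
    have h2 := hγη h1
    have h3 := dist_triangle (γ (Set.projIcc 0 1 zero_le_one (g x))) (γ (u x)) x
    linarith [huγ x]
  have h1 := mul_meas_ge_le_integral_of_nonneg (Eventually.of_forall fun x => norm_nonneg _)
    (hint.sub hgint).norm η
  have h2 : η * μ.real {x | η ≤ ‖(u x : ℝ) - g x‖} ≤ η * δ := h1.trans hg
  exact (measureReal_mono hsub).trans (le_of_mul_le_mul_left h2 hη)

theorem IsApproximatelyPathConnected.exists_ae_tendsto (hX : IsApproximatelyPathConnected X)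
    (μ : Measure X) [IsProbabilityMeasure μ] :
    ∃ (γ : ℕ → C(I, X)) (h : ℕ → C(X, I)),
      ∀ᵐ x ∂μ, Tendsto (fun n => γ n (h n x)) atTop (𝓝 x) := by
  choose γ h hγ using fun n : ℕ => hX.exists_measureReal_le μ (δ := 1 / ((n : ℝ) + 1))
    (by positivity)
  have hlim : TendstoInMeasure μ (fun n x => γ n (h n x)) atTop fun x => x := by
    refine tendstoInMeasure_iff_measureReal_dist.2 fun ε hε => ?_
    have h0 := tendsto_one_div_add_atTop_nhds_zero_nat (𝕜 := ℝ)
    refine squeeze_zero' (Eventually.of_forall fun n => measureReal_nonneg) ?_ h0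
    filter_upwards [h0.eventually_lt_const hε] with n hn
    exact (measureReal_mono fun x hx => hn.le.trans hx).trans (hγ n)
  obtain ⟨ns, -, hns⟩ := hlim.exists_seq_tendsto_ae
  exact ⟨fun n => γ (ns n), fun n => h (ns n), hns⟩

end Factorization

/-! ### The algebra `C[0,1]` is C⋆-tracially stable -/

namespace TracialUltraproduct

open Filter unitInterval

variable {ι : Type v} {B : ι → Type w} [∀ i, CStarAlgebra (B i)]

/-- The bounded family `(φ i a)` given by ⋆-homomorphisms `φ i`. -/
noncomputable def ofHoms {A : Type u} [CStarAlgebra A] (φ : ∀ i, A →⋆ₐ[ℂ] B i) (a : A) :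
    lp B ∞ :=
  ⟨fun i => φ i a, memℓp_infty ⟨‖a‖, by
    rintro _ ⟨i, rfl⟩
    exact NonUnitalStarAlgHom.norm_apply_le (φ i) a⟩⟩

theorem ofHoms_apply {A : Type u} [CStarAlgebra A] (φ : ∀ i, A →⋆ₐ[ℂ] B i) (a : A) (i : ι) :
    ofHoms φ a i = φ i a := rfl

theorem norm_ofHoms_le {A : Type u} [CStarAlgebra A] (φ : ∀ i, A →⋆ₐ[ℂ] B i) (a : A) :
    ‖ofHoms φ a‖ ≤ ‖a‖ :=
  lp.norm_le_of_forall_le (norm_nonneg a) fun i => NonUnitalStarAlgHom.norm_apply_le (φ i) a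

variable [∀ i, Nontrivial (B i)] (α : Ultrafilter ι) (ρ : ∀ i, TracialState (B i))

/-- The squared `2`-norm of a tracial ultraproduct. -/
noncomputable def sqNorm (x : TracialUltraproduct α ρ) : ℝ := (trace α ρ (star x * x)).re

theorem sqNorm_nonneg (x : TracialUltraproduct α ρ) : 0 ≤ sqNorm α ρ x :=
  (Complex.nonneg_iff.1 (trace_star_mul_self_nonneg α ρ x)).1

theorem sqNorm_add_le (x y : TracialUltraproduct α ρ) :
    sqNorm α ρ (x + y) ≤ 2 * sqNorm α ρ x + 2 * sqNorm α ρ y := by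
  obtain ⟨a, rfl⟩ := mk_surjective α ρ x
  obtain ⟨b, rfl⟩ := mk_surjective α ρ y
  exact le_of_tendsto_of_tendsto' (tendsto_twoNorm_sq α ρ (a + b))
    (((tendsto_twoNorm_sq α ρ a).const_mul 2).add ((tendsto_twoNorm_sq α ρ b).const_mul 2))
    fun i => (ρ i).twoNorm_add_sq_le (a i) (b i)

theorem eq_zero_of_sqNorm_eq_zero {x : TracialUltraproduct α ρ} (h : sqNorm α ρ x = 0) :
    x = 0 := by
  obtain ⟨a, rfl⟩ := mk_surjective α ρ x
  refine (mk_eq_mk_iff α ρ (b := 0)).2 ?_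
  have h2 := tendsto_twoNorm_sq α ρ a
  rw [sqNorm] at h
  rw [h] at h2
  simpa using h2

theorem sqNorm_mk_le (a : lp B ∞) : sqNorm α ρ (mk α ρ a) ≤ ‖a‖ ^ 2 := by
  refine le_of_tendsto' (tendsto_twoNorm_sq α ρ a) fun i => ?_
  have h : (ρ i).twoNorm (a i) ≤ ‖a‖ :=
    ((ρ i).twoNorm_le_norm _).trans (lp.norm_apply_le_norm ENNReal.top_ne_zero a i)
  have h0 : 0 ≤ (ρ i).twoNorm (a i) := Real.sqrt_nonneg _
  gcongr

theorem sqNorm_hom_le {X : Type*} [TopologicalSpace X] [CompactSpace X] [T2Space X]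
    (π : C(X, ℂ) →⋆ₐ[ℂ] TracialUltraproduct α ρ) (f : C(X, ℂ)) :
    sqNorm α ρ (π f) ≤ ‖f‖ ^ 2 := by
  have h := (isState_comp α ρ π).norm_apply_le (star f * f)
  rw [CStarRing.norm_star_mul_self, ← sq] at h
  refine le_trans ?_ ((Complex.re_le_norm _).trans h)
  simp [sqNorm, map_star]

theorem sqNorm_hom_eq_integral {X : Type*} [TopologicalSpace X] [CompactSpace X]
    [MeasurableSpace X] {μ : MeasureTheory.Measure X}
    {π : C(X, ℂ) →⋆ₐ[ℂ] TracialUltraproduct α ρ} (hμ : ∀ f, trace α ρ (π f) = ∫ x, f x ∂μ)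
    (f : C(X, ℂ)) : sqNorm α ρ (π f) = ∫ x, ‖f x‖ ^ 2 ∂μ := by
  have h : ∀ x, (star f * f) x = ((‖f x‖ ^ 2 : ℝ) : ℂ) := fun x => by
    rw [ContinuousMap.mul_apply, ContinuousMap.star_apply, RCLike.star_def, Complex.conj_mul']
    norm_cast
  rw [sqNorm, ← map_star π, ← map_mul, hμ]
  simp_rw [h]
  rw [integral_complex_ofReal, Complex.ofReal_re]

/-- Every coset of a selfadjoint element contains a family of selfadjoint elements. -/
theorem exists_isSelfAdjoint_mk_eq {x : TracialUltraproduct α ρ} (hx : star x = x) :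
    ∃ b : lp B ∞, (∀ i, IsSelfAdjoint (b i)) ∧ mk α ρ b = x := by
  obtain ⟨a, rfl⟩ := mk_surjective α ρ x
  refine ⟨(2⁻¹ : ℂ) • (a + star a), fun i => ?_, ?_⟩
  · rw [IsSelfAdjoint]
    change star ((2⁻¹ : ℂ) • (a i + star (a i))) = (2⁻¹ : ℂ) • (a i + star (a i))
    simp [star_smul, add_comm]
  · rw [mk_smul, mk_add, ← star_mk, hx, ← two_smul ℂ, smul_smul]
    simp

/-- Every unital ⋆-homomorphism of `C[0,1]` into a tracial ultraproduct lifts: the image of the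
coordinate function has a selfadjoint lift `b`, and the functional calculus of `b i`, after
clipping to `[0,1]`, lifts the homomorphism, as both sides agree on polynomials. -/
theorem exists_lift_unitInterval (θ : C(I, ℂ) →⋆ₐ[ℂ] TracialUltraproduct α ρ) :
    ∃ χ : ∀ i, C(I, ℂ) →⋆ₐ[ℂ] B i, ∀ F, mk α ρ (ofHoms χ F) = θ F := by
  let id' : C(I, ℂ) := ⟨fun t => ((t : ℝ) : ℂ), by fun_prop⟩
  have hid : star id' = id' := by
    ext t
    simp [id']
  obtain ⟨b, hb, hbθ⟩ := exists_isSelfAdjoint_mk_eq α ρ (x := θ id') (by rw [← map_star, hid])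
  -- a common disc containing `[0,1]` and the spectra of all `b i`
  let s : Set ℂ := Metric.closedBall 0 (max ‖b‖ 1)
  have : CompactSpace s := isCompact_iff_compactSpace.1 (isCompact_closedBall _ _)
  have hspec : ∀ i, spectrum ℂ (b i) ⊆ s := fun i z hz => by
    rw [mem_closedBall_zero_iff]
    exact ((spectrum.norm_le_norm_of_mem hz).trans
      (lp.norm_apply_le_norm ENNReal.top_ne_zero b i)).trans (le_max_left _ _)
  let j : C(I, s) := ⟨fun t => ⟨((t : ℝ) : ℂ), by
    rw [mem_closedBall_zero_iff, Complex.norm_real, Real.norm_of_nonneg t.2.1]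
    exact t.2.2.trans (le_max_right _ _)⟩, by fun_prop⟩
  let κ : C(s, I) := ⟨fun z => Set.projIcc 0 1 zero_le_one (z : ℂ).re,
    continuous_projIcc.comp (Complex.continuous_re.comp continuous_subtype_val)⟩
  let χ : ∀ i, C(s, ℂ) →⋆ₐ[ℂ] B i := fun i =>
    (cfcHom (hb i).isStarNormal).comp
      (ContinuousMap.compStarAlgHom' ℂ ℂ (⟨Set.inclusion (hspec i),
        continuous_inclusion (hspec i)⟩ : C(spectrum ℂ (b i), s)))
  have key : ∀ F : C(s, ℂ), mk α ρ (ofHoms χ F) = θ (F.comp j) := fun F => by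
    induction F using ContinuousMap.induction_on_of_compact with
    | const r =>
      have h1 : ofHoms χ (ContinuousMap.const s r) = algebraMap ℂ _ r := by
        ext i
        exact AlgHomClass.commutes (χ i) r
      rw [h1]
      exact (AlgHomClass.commutes θ r).symm
    | id =>
      have h1 : ofHoms χ (.restrict s (.id ℂ)) = b := by
        ext i
        exact cfcHom_id (hb i).isStarNormal
      rw [h1, hbθ]
      rfl
    | star_id =>
      have h1 : ofHoms χ (star (.restrict s (.id ℂ))) = star b := by
        ext i
        rw [ofHoms_apply, map_star]
        exact congrArg star (cfcHom_id (hb i).isStarNormal)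
      rw [h1, ← star_mk, hbθ, ← map_star]
      rfl
    | add f g hf hg =>
      have h1 : ofHoms χ (f + g) = ofHoms χ f + ofHoms χ g := by
        ext i
        exact map_add (χ i) f g
      rw [h1, mk_add, hf, hg, ← map_add]
      rfl
    | mul f g hf hg =>
      have h1 : ofHoms χ (f * g) = ofHoms χ f * ofHoms χ g := by
        ext i
        exact map_mul (χ i) f g
      rw [h1, mk_mul, hf, hg, ← map_mul]
      rfl
    | frequently f hf =>
      rw [← sub_eq_zero]
      refine eq_zero_of_sqNorm_eq_zero α ρ (le_antisymm ?_ (sqNorm_nonneg α ρ _))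
      have hle : ∀ g, mk α ρ (ofHoms χ g) = θ (g.comp j) →
          sqNorm α ρ (mk α ρ (ofHoms χ f) - θ (f.comp j)) ≤ 4 * ‖f - g‖ ^ 2 := fun g hg => by
        have h1 : ofHoms χ (f - g) = ofHoms χ f - ofHoms χ g := by
          ext i
          exact map_sub (χ i) f g
        have h2 : mk α ρ (ofHoms χ f) - θ (f.comp j) =
            mk α ρ (ofHoms χ (f - g)) + θ ((g - f).comp j) := by
          have h3 : (g - f).comp j = g.comp j - f.comp j := rfl
          rw [h1, mk_sub, h3, map_sub, ← hg]
          abel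
        have h4 : sqNorm α ρ (mk α ρ (ofHoms χ (f - g))) ≤ ‖f - g‖ ^ 2 :=
          (sqNorm_mk_le α ρ _).trans (by gcongr; exact norm_ofHoms_le χ _)
        have h5 : sqNorm α ρ (θ ((g - f).comp j)) ≤ ‖f - g‖ ^ 2 := by
          refine (sqNorm_hom_le α ρ θ _).trans ?_
          rw [norm_sub_rev f g]
          gcongr
          exact (ContinuousMap.norm_le _ (norm_nonneg _)).2 fun t => (g - f).norm_coe_le_norm (j t)
        rw [h2]
        linarith [sqNorm_add_le α ρ (mk α ρ (ofHoms χ (f - g))) (θ ((g - f).comp j))]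
      refine le_of_forall_pos_le_add fun ε hε => ?_
      have hcont : Tendsto (fun g => 4 * ‖f - g‖ ^ 2) (𝓝 f) (𝓝 (4 * ‖f - f‖ ^ 2)) :=
        Continuous.tendsto (by fun_prop) f
      rw [sub_self, norm_zero, zero_pow two_ne_zero, mul_zero] at hcont
      obtain ⟨g, hg, hgε⟩ := (hf.and_eventually (hcont.eventually_lt_const hε)).exists
      linarith [hle g hg]
  refine ⟨fun i => (χ i).comp (κ.compStarAlgHom' ℂ ℂ), fun F => (key (F.comp κ)).trans ?_⟩
  congr 1
  ext t
  simp [κ, j]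

end TracialUltraproduct

/-! ### Lifting homomorphisms of `C(X)` -/

open Filter in
/-- Along a nontrivial ultrafilter one can pass to a diagonal of countably many large sets. -/
theorem Ultrafilter.IsNontrivial.exists_diagonal {I : Type*} {α : Ultrafilter I}
    (hα : α.IsNontrivial) {G : ℕ → Set I} (hG : ∀ n, G n ∈ α) :
    ∃ ν : I → ℕ, Tendsto ν α atTop ∧ ∀ᶠ i in (α : Filter I), i ∈ G (ν i) := by
  classical
  obtain ⟨E, hE, hE0⟩ := hα
  -- for `i` in `H 0`, the value `ν i` is the last index `n` with `i` in `H n`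
  let H : ℕ → Set I := fun n => ⋂ m ∈ Set.Iic n, (G m ∩ E m)
  have hH : ∀ n, H n ∈ α := fun n =>
    (biInter_mem (Set.finite_Iic n)).2 fun m _ => inter_mem (hG m) (hE m)
  have hHmem : ∀ {n i}, i ∈ H n → ∀ m ≤ n, i ∈ G m ∩ E m := fun h m hm =>
    Set.mem_iInter₂.1 h m hm
  have hHanti : ∀ {m n i}, m ≤ n → i ∈ H n → i ∈ H m := fun hmn h =>
    Set.mem_iInter₂.2 fun k hk => hHmem h k (le_trans hk hmn)
  have hex : ∀ i, ∃ n, i ∉ H n := fun i => by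
    by_contra! h
    have : i ∈ ⋂ n, E n := Set.mem_iInter.2 fun n => (hHmem (h n) n le_rfl).2
    rwa [hE0] at this
  have hfind : ∀ {n i}, i ∈ H n → n ≤ Nat.find (hex i) - 1 := fun {n i} h => by
    refine Nat.le_sub_one_of_lt (lt_of_not_ge fun hle => ?_)
    exact Nat.find_spec (hex i) (hHanti hle h)
  refine ⟨fun i => Nat.find (hex i) - 1, tendsto_atTop.2 fun n => mem_of_superset (hH n)
    fun i hi => hfind hi, mem_of_superset (hH 0) fun i hi => ?_⟩
  have hpos : 0 < Nat.find (hex i) := (Nat.find_pos _).2 (not_not.2 hi)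
  exact (hHmem (not_not.1 (Nat.find_min (hex i) (Nat.sub_one_lt hpos.ne'))) _ le_rfl).1

open MeasureTheory Filter TracialUltraproduct in
/-- If `γ n ∘ h n` tends to the identity almost everywhere for the measure that `π` induces on `X`,
then `π` is the limit in `2`-norm of the homomorphisms `f ↦ π (f ∘ γ n ∘ h n)`. These factor through
`C[0,1]`, hence lift, and a diagonal of their lifts lifts `π`. -/
theorem IsApproximatelyPathConnected.isCStarTraciallyStable {X : Type u} [MetricSpace X]
    [CompactSpace X] (hX : IsApproximatelyPathConnected X) :
    IsCStarTraciallyStable.{u, v, w} C(X, ℂ) := by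
  intro I α hα B _ _ ρ π
  let _ : MeasurableSpace X := borel X
  have : BorelSpace X := ⟨rfl⟩
  obtain ⟨μ, hμ, hμπ⟩ := (isState_comp α ρ π).exists_measure
  obtain ⟨γ, h, hγh⟩ := hX.exists_ae_tendsto μ
  choose χ hχ using fun n => exists_lift_unitInterval α ρ (π.comp ((h n).compStarAlgHom' ℂ ℂ))
  choose a ha using fun f : C(X, ℂ) => mk_surjective α ρ (π f)
  let ψ : ℕ → ∀ i, C(X, ℂ) →⋆ₐ[ℂ] B i := fun n i => (χ n i).comp ((γ n).compStarAlgHom' ℂ ℂ)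
  let r : ℕ → C(X, ℂ) → ℝ := fun n f => ∫ x, ‖f (γ n (h n x)) - f x‖ ^ 2 ∂μ
  have hψ : ∀ n f, Tendsto (fun i => (ρ i).twoNorm (ψ n i f - a f i) ^ 2) α (𝓝 (r n f)) :=
    fun n f => by
    have h1 := tendsto_twoNorm_sq α ρ (ofHoms (ψ n) f - a f)
    have h2 : mk α ρ (ofHoms (ψ n) f - a f) = π (f.comp ((γ n).comp (h n)) - f) := by
      rw [mk_sub, ha, map_sub]
      exact congrArg (· - π f) (hχ n (f.comp (γ n)))
    have h3 := sqNorm_hom_eq_integral α ρ hμπ (f.comp ((γ n).comp (h n)) - f)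
    rw [sqNorm] at h3
    rw [h2, h3] at h1
    exact h1
  have hr : ∀ f, Tendsto (fun n => r n f) atTop (𝓝 0) := fun f => by
    have h1 : Tendsto (fun n => r n f) atTop (𝓝 (∫ _, (0 : ℝ) ∂μ)) := by
      refine tendsto_integral_of_dominated_convergence (fun _ => (‖f‖ + ‖f‖) ^ 2)
        (fun n => ?_) (integrable_const _) (fun n => Eventually.of_forall fun x => ?_) ?_
      · have : Continuous fun x => ‖f (γ n (h n x)) - f x‖ ^ 2 := by fun_prop
        exact this.aestronglyMeasurable
      · rw [norm_pow, norm_norm]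
        gcongr
        exact (norm_sub_le _ _).trans (add_le_add (f.norm_coe_le_norm _) (f.norm_coe_le_norm _))
      · filter_upwards [hγh] with x hx
        simpa using ((((f.continuous.tendsto x).comp hx).sub_const (f x)).norm.pow 2)
    rwa [integral_zero] at h1
  let e := TopologicalSpace.denseSeq C(X, ℂ)
  have hG : ∀ n : ℕ, {i | ∀ k ∈ Set.Iic n, (ρ i).twoNorm (ψ n i (e k) - a (e k) i) ^ 2 <
      r n (e k) + 1 / ((n : ℝ) + 1)} ∈ α := fun n =>
    (eventually_all_finite (Set.finite_Iic n)).2 fun k _ =>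
      (hψ n (e k)).eventually_lt_const (lt_add_of_pos_right _ (by positivity))
  obtain ⟨ν, hν, hνG⟩ := hα.exists_diagonal hG
  let φ : ∀ i, C(X, ℂ) →⋆ₐ[ℂ] B i := fun i => ψ (ν i) i
  refine ⟨Set.univ, univ_mem, fun i => φ i, fun f => ?_⟩
  have hext : extendByZero Set.univ (fun i : (Set.univ : Set I) => φ i) f = ofHoms φ f := by
    ext i
    exact dif_pos (Set.mem_univ i)
  rw [hext, ← ha, eq_comm, mk_eq_mk_iff]
  refine tendsto_zero_of_denseRange (TopologicalSpace.denseRange_denseSeq C(X, ℂ)) (C := 2)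
    (d := fun i f => (ρ i).twoNorm (φ i f - a f i) ^ 2) (fun i f => sq_nonneg _)
    (fun f ε hε => ⟨min 1 (ε / 16), by positivity, fun f' hf' => ?_⟩) (fun k => ?_) f
  · have h1 := tendsto_twoNorm_sq α ρ (a f' - a f)
    rw [mk_sub, ha, ha, ← map_sub] at h1
    have h2 : (trace α ρ (star (π (f' - f)) * π (f' - f))).re ≤ ‖f - f'‖ ^ 2 := by
      rw [norm_sub_rev]
      exact sqNorm_hom_le α ρ π (f' - f)
    have h3 : ‖f - f'‖ ^ 2 ≤ ε / 16 := by
      rw [dist_eq_norm] at hf'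
      have h4 := hf'.trans_le (min_le_left _ _)
      have h5 := hf'.trans_le (min_le_right _ _)
      nlinarith [norm_nonneg (f - f')]
    filter_upwards [h1.eventually_lt_const (h2.trans_lt (lt_add_of_pos_right _
      (by positivity : 0 < ε / 16)))] with i hi
    have h6 : φ i f - a f i = (φ i f' - a f' i) + (φ i (f - f') + (a f' - a f : lp B ∞) i) := by
      rw [map_sub, lp.coeFn_sub, Pi.sub_apply]
      abel
    have h7 : (ρ i).twoNorm (φ i (f - f')) ^ 2 ≤ ‖f - f'‖ ^ 2 := by
      have h8 := ((ρ i).twoNorm_le_norm _).trans (NonUnitalStarAlgHom.norm_apply_le (φ i) (f - f'))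
      have h9 : 0 ≤ (ρ i).twoNorm (φ i (f - f')) := Real.sqrt_nonneg _
      gcongr
    have h10 := (ρ i).twoNorm_add_sq_le (φ i f' - a f' i) (φ i (f - f') + (a f' - a f : lp B ∞) i)
    have h11 := (ρ i).twoNorm_add_sq_le (φ i (f - f')) ((a f' - a f : lp B ∞) i)
    rw [h6]
    linarith
  · have h1 : Tendsto (fun n : ℕ => r n (e k) + 1 / ((n : ℝ) + 1)) atTop (𝓝 0) := by
      simpa using (hr (e k)).add tendsto_one_div_add_atTop_nhds_zero_nat
    refine squeeze_zero' (Eventually.of_forall fun i => sq_nonneg _) ?_ (h1.comp hν)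
    filter_upwards [hνG, hν.eventually (eventually_ge_atTop k)] with i hi hk
    exact (hi k hk).le

theorem mainTheorem2 (X : Type u) [MetricSpace X] [CompactSpace X] :
    List.TFAE [
      IsCStarTraciallyStable.{u, v, w} C(X, ℂ),
      IsApproximatelyPathConnected X,
      ∀ τ : C(X, ℂ) →ₗ[ℂ] ℂ, IsState τ →
        ∃ π : ℕ → (C(X, ℂ) →⋆ₐ[ℂ] C(unitInterval, ℂ)), ∀ f : C(X, ℂ),
          Filter.Tendsto (fun n => ∫ x : unitInterval, π n f x) Filter.atTop (𝓝 (τ f))] := by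
  tfae_have 1 → 3 := fun h τ hτ => h.exists_tendsto_integral τ hτ
  tfae_have 3 → 2 := isApproximatelyPathConnected_of_states
  tfae_have 2 → 1 := fun h => h.isCStarTraciallyStable
  tfae_finish
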